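/- All graphs are finite and simple. Let $\ell$ be a positive integer, let $s \ge 2\ell$ and $t \ge 1$ be integers, and let $G$ be a graph. Let $K_s + I_t$ be the graph obtained from the disjoint union of the complete graph $K_s$ and the edgeless graph $I_t$ on $t$ vertices by adding all edges between them. Let $H$ be a subgraph of $G$ that is bipartite and is a subdivision of $K_s + I_t$; that is, $H$ is obtained from $K_s+I_t$ by replacing its edges with internally disjoint paths, called the linking paths. Let $C$ be the set of the $s+t$ branch vertices of $H$ (those corresponding to the vertices of $K_s + I_t$), and let $\beta : V(H) \to \{1,2\}$ be a proper coloring of $H$, which is unique up to exchanging the colors. A $C$-path is a path in $G$ that joins two distinct vertices of $C$ (its internal vertices are arbitrary); a $C$-path $P$ with ends $u, v$ is parity-breaking with respect to $H$ if $|E(P)| \not\equiv \beta(u) - \beta(v) \pmod 2$. A block of a graph is a maximal connected subgraph that has no cutvertex. Then at least one of the following holds. 1. There are a set $X \subseteq V(G)$ with $|X| \le 2\ell - 2$, a block $U$ of $G - X$ that is bipartite, and a set $C' \subseteq C \setminus X$ with $|C'| \ge s + t - |X|$ such that $U$ contains $C'$ and all linking paths of $H$ between vertices of $C'$. 2. $G$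 has $\ell$ pairwise vertex-disjoint $C$-paths that are parity-breaking with respect to $H$. -/

import Mathlib

namespace ParityBreak

open SimpleGraph

/-- The join `G + H`: the disjoint union of `G` and `H` together with all edges between them. -/
def join {V W : Type*} (G : SimpleGraph V) (H : SimpleGraph W) : SimpleGraph (V ⊕ W) :=
  (G ⊕g H) ⊔ completeBipartiteGraph V W

/-- The graph `K_s + I_t`, where `I_t` is the graph on `t` vertices without edges. -/
def completeJoinIndep (s t : ℕ) : SimpleGraph (Fin s ⊕ Fin t) :=
  join (⊤ : SimpleGraph (Fin s)) (⊥ : SimpleGraph (Fin t))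

/-- An `F`-subdivision in `G`, given by its (distinct) branch vertices and its linking paths.
Every edge `ab` of `F` is replaced by a path `link a b` of `G` (the same path for `ba`,
reversed) that joins the branch vertices of `a` and `b`; no linking path has a branch vertex as
an internal vertex, and linking paths of different edges meet only in branch vertices, so that
the linking paths are internally disjoint. -/
structure Subdivision {W V : Type*} (F : SimpleGraph W) (G : SimpleGraph V) where
  branch : W ↪ V
  link : ∀ a b : W, F.Adj a b → G.Walk (branch a) (branch b)
  link_symm : ∀ (a b : W) (h : F.Adj a b), link b a h.symm = (link a b h).reverse
  link_isPath : ∀ (a b : W) (h : F.Adj a b), (link a b h).IsPath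
  branch_mem_link : ∀ (a b : W) (h : F.Adj a b) (c : W),
    branch c ∈ (link a b h).support → c = a ∨ c = b
  link_inter : ∀ (a b : W) (h : F.Adj a b) (c d : W) (h' : F.Adj c d), s(a, b) ≠ s(c, d) →
    ∀ v : V, v ∈ (link a b h).support → v ∈ (link c d h').support → v ∈ Set.range branch

namespace Subdivision

variable {W V : Type*} {F : SimpleGraph W} {G : SimpleGraph V}

/-- The set of all branch vertices. -/
def branchSet (S : Subdivision F G) : Set V := Set.range S.branch

/-- The subdivision as a subgraph of `G`: the union of the branch vertices and linking paths. -/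
def toSubgraph (S : Subdivision F G) : G.Subgraph :=
  (⨆ a : W, G.singletonSubgraph (S.branch a)) ⊔
    ⨆ (a : W) (b : W) (h : F.Adj a b), (S.link a b h).toSubgraph

end Subdivision

/-- An `S`-path: a path that joins two distinct vertices of `S`. -/
def IsSetPath {V : Type*} {G : SimpleGraph V} (S : Set V) {u v : V} (p : G.Walk u v) : Prop :=
  p.IsPath ∧ u ∈ S ∧ v ∈ S ∧ u ≠ v

/-- For a two-colouring `α` of `S`, an `S`-path with ends `u` and `v` is parity-breaking with
respect to `α` if its length is not congruent to `α u - α v` modulo `2`. -/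
def IsParityBreakingColoring {V : Type*} {G : SimpleGraph V} {S : Set V} (α : S → Fin 2)
    {u v : V} (p : G.Walk u v) : Prop :=
  IsSetPath S p ∧ ∃ (hu : u ∈ S) (hv : v ∈ S),
    ¬ ((p.length : ℤ) ≡ ((α ⟨u, hu⟩ : ℕ) : ℤ) - ((α ⟨v, hv⟩ : ℕ) : ℤ) [ZMOD 2])

/-- For a connected bipartite subgraph `H` of `G`, a `V(H)`-path is parity-breaking with respect
to `H` if it is so with respect to a proper two-colouring of `H`. That colouring is unique up to
exchanging the colours, so it does not matter which one is taken. -/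
def IsParityBreaking {V : Type*} {G : SimpleGraph V} (H : G.Subgraph) {u v : V}
    (p : G.Walk u v) : Prop :=
  ∃ β : H.coe.Coloring (Fin 2), IsParityBreakingColoring (S := H.verts) β p

/-- `G` has `n` (pairwise) vertex-disjoint `C`-paths that are parity-breaking with respect
to `H`. -/
def HasDisjointParityBreakingPaths {V : Type*} (G : SimpleGraph V) (H : G.Subgraph) (C : Set V)
    (n : ℕ) : Prop :=
  ∃ (x y : Fin n → V) (P : ∀ i, G.Walk (x i) (y i)),
    (∀ i, IsSetPath C (P i) ∧ IsParityBreaking H (P i)) ∧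
    ∀ i j, i ≠ j → (P i).support.Disjoint (P j).support

/-- A connected subgraph without a cutvertex (of its own). -/
def IsNonseparable {V : Type*} {G : SimpleGraph V} (B : G.Subgraph) : Prop :=
  B.Connected ∧ ∀ v ∈ B.verts, (B.deleteVerts {v}).Preconnected

/-- A block of the subgraph `D`: a maximal connected subgraph of `D` without a cutvertex. -/
def IsBlockOf {V : Type*} {G : SimpleGraph V} (D B : G.Subgraph) : Prop :=
  Maximal (fun B' : G.Subgraph => B' ≤ D ∧ IsNonseparable B') B

end ParityBreak

namespace ParityBreak

open SimpleGraph

/-! ### Paths of both parities in 2-connected nonbipartite graphs -/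

section Walks

variable {V : Type*} {K : SimpleGraph V}

/-! The core is a packing and covering statement, `exists_disjoint_paths_or_hitting_set`: without
`l` disjoint parity-breaking `C`-paths, some set `X` of at most `2 * l - 2` vertices meets all of
them.

It is deduced from Tutte's theorem. Take two copies of `G`, the levels, with a rung between the two
copies of each vertex outside `C`; of `c ∈ C` only the copy on level `b c` keeps its edges.
Superpose a matching and the rungs: an alternating path that leaves `C` changes level at every
internal vertex, so when it returns to `C` its projection to `G` breaks parity. A clique of `2 * |C|
- 2 * l` further vertices, joined to all copies of vertices of `C`, can absorb all but `2 * l` of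
these copies. Hence a perfect matching yields `l` disjoint paths. Otherwise a Tutte set `S` leaves
at least `|S| + 2` odd components. In the essential case each contains a lonely element; `X`
consists of the blocked vertices and the projections of all lonely elements except one per odd
component. A parity-breaking path that avoids `X`, lifted to the levels, would connect two lonely
elements within one component, which is impossible.

Given `X`, charge each of its vertices to one vertex of `K_s + I_t` and drop those. At least two
vertices of `K_s` survive, so the remaining subdivision is nonseparable and lies in a block `U` of
`G - X`. If `U` were not bipartite, growing ears from an odd cycle would give paths of both parities
between any two of its vertices (`joinedByBothParities_univ`), among them a parity-breaking one that
avoids `X`. -/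

lemma isPath_append_of_inter {u v w : V} {p : K.Walk u v} {q : K.Walk v w} (hp : p.IsPath)
    (hq : q.IsPath) (h : ∀ a ∈ p.support, a ∈ q.support → a = v) : (p.append q).IsPath := by
  rw [Walk.isPath_def, Walk.support_append]
  refine List.Nodup.append hp.support_nodup (hq.support_nodup.sublist (List.tail_sublist _)) ?_
  intro a ha ha'
  obtain rfl := h a ha (List.mem_of_mem_tail ha')
  have := hq.support_nodup
  rw [← Walk.cons_tail_support] at this
  exact (List.nodup_cons.mp this).1 ha'

lemma eq_of_mem_of_isPath_append {u v w : V} {p : K.Walk u v} {q : K.Walk v w}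
    (h : (p.append q).IsPath) {a : V} (hp : a ∈ p.support) (hq : a ∈ q.support) : a = v := by
  by_contra hne
  exact h.ne_of_mem_support_of_append hne hp hq rfl

/-- Two vertices of a walk cut it into three pieces. -/
lemma exists_append_append {x y u v : V} (r : K.Walk x y) (hu : u ∈ r.support)
    (hv : v ∈ r.support) :
    (∃ (r₁ : K.Walk x u) (r₂ : K.Walk u v) (r₃ : K.Walk v y), r = r₁.append (r₂.append r₃)) ∨
    (∃ (r₁ : K.Walk x v) (r₂ : K.Walk v u) (r₃ : K.Walk u y), r = r₁.append (r₂.append r₃)) := by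
  obtain ⟨q, s, rfl⟩ := r.mem_support_iff_exists_append.mp hu
  rw [Walk.mem_support_append_iff] at hv
  rcases hv with hv | hv
  · obtain ⟨q₁, q₂, rfl⟩ := q.mem_support_iff_exists_append.mp hv
    exact Or.inr ⟨q₁, q₂, s, by rw [Walk.append_assoc]⟩
  · obtain ⟨s₁, s₂, rfl⟩ := s.mem_support_iff_exists_append.mp hv
    exact Or.inl ⟨q, s₁, s₂, rfl⟩

/-- Going around the other way: if `r` runs `x, u, v, y` and `a` leads from `x` to `y` outside
of `r`, then one can go from `u` to `v` via `a`. -/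
lemma isPath_detour {x y u v : V} {r₁ : K.Walk x u} {r₂ : K.Walk u v} {r₃ : K.Walk v y}
    (hr : (r₁.append (r₂.append r₃)).IsPath) (huv : u ≠ v) {a : K.Walk x y} (ha : a.IsPath)
    (h₁ : ∀ w ∈ a.support, w ∈ r₁.support → w = x) (h₃ : ∀ w ∈ a.support, w ∈ r₃.support → w = y) :
    (r₁.reverse.append (a.append r₃.reverse)).IsPath := by
  have h23 := hr.of_append_right
  refine isPath_append_of_inter hr.of_append_left.reverse
    (isPath_append_of_inter ha h23.of_append_right.reverse ?_) ?_
  · intro w hw hw'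
    exact h₃ w hw (by simpa using hw')
  · intro w hw hw'
    simp only [Walk.support_reverse, List.mem_reverse, Walk.mem_support_append_iff] at hw hw'
    rcases hw' with hw' | hw'
    · exact h₁ w hw' hw
    · have h : w = u := eq_of_mem_of_isPath_append hr hw
        ((Walk.mem_support_append_iff _ _).2 (Or.inr hw'))
      subst h
      exact absurd (eq_of_mem_of_isPath_append h23 (Walk.start_mem_support _) hw') huv

/-- Either the graph has an odd cycle, or every walk contains a path of the same parity. -/
lemma exists_even_path_of_adj_or_exists_isPath [DecidableEq V] {u v : V} (w : K.Walk u v) :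
    (∃ (x y : V) (_ : K.Adj x y) (p : K.Walk x y), p.IsPath ∧ Even p.length) ∨
      ∃ p : K.Walk u v, p.IsPath ∧ Even (p.length + w.length) := by
  induction w with
  | nil => exact Or.inr ⟨Walk.nil, by simp, by simp⟩
  | @cons a b c h w ih =>
    rcases ih with ih | ⟨q, hq, hpar⟩
    · exact Or.inl ih
    -- If `a` lies on `q`, the edge and `q₁` close a cycle. Either it is odd, or dropping it
    -- preserves parity.
    by_cases ha : a ∈ q.support
    · obtain ⟨q₁, q₂, rfl⟩ := q.mem_support_iff_exists_append.mp ha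
      by_cases he : Even q₁.length
      · exact Or.inl ⟨b, a, h.symm, q₁, hq.of_append_left, he⟩
      · refine Or.inr ⟨q₂, hq.of_append_right, ?_⟩
        simp only [Walk.length_append, Walk.length_cons] at hpar ⊢
        grind
    · refine Or.inr ⟨Walk.cons h q, hq.cons ha, ?_⟩
      simp only [Walk.length_cons]
      grind

lemma exists_even_path_of_adj (h : ¬ K.Colorable 2) :
    ∃ (x y : V) (_ : K.Adj x y) (p : K.Walk x y), p.IsPath ∧ Even p.length := by
  classical
  rw [two_colorable_iff_forall_loop_even] at h
  push Not at h
  obtain ⟨u, w, hw⟩ := h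
  refine (exists_even_path_of_adj_or_exists_isPath w).resolve_right ?_
  rintro ⟨p, hp, hpar⟩
  rw [(Walk.isPath_iff_nil.mp hp).eq_nil] at hpar
  grind [Walk.length_nil]

/-- Inside `Z`, any two vertices of `Z` are joined by paths of both parities. -/
def JoinedByBothParities (K : SimpleGraph V) (Z : Set V) : Prop :=
  ∀ u ∈ Z, ∀ v ∈ Z, u ≠ v → ∀ k : ℕ,
    ∃ p : K.Walk u v, p.IsPath ∧ (∀ a ∈ p.support, a ∈ Z) ∧ Even (p.length + k)

/-- The edge closes the path to an odd cycle, whose two arcs between any two vertices have different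
parities. -/
lemma joinedByBothParities_of_even_path {x y : V} (hxy : K.Adj x y) {p : K.Walk x y}
    (hp : p.IsPath) (he : Even p.length) : JoinedByBothParities K {a | a ∈ p.support} := by
  suffices H : ∀ u v, u ≠ v → (∃ (r₁ : K.Walk x u) (r₂ : K.Walk u v) (r₃ : K.Walk v y),
      p = r₁.append (r₂.append r₃)) → ∀ k : ℕ,
      ∃ q : K.Walk u v, q.IsPath ∧ (∀ a ∈ q.support, a ∈ p.support) ∧ Even (q.length + k) by
    intro u hu v hv huv k
    rcases exists_append_append p hu hv with h | h
    · exact H u v huv h k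
    · obtain ⟨q, hq, hs, hk⟩ := H v u huv.symm h k
      exact ⟨q.reverse, hq.reverse, fun a ha => hs a (by simpa using ha), by simpa using hk⟩
  rintro u v huv ⟨r₁, r₂, r₃, rfl⟩ k
  by_cases hk : Even (r₂.length + k)
  · exact ⟨r₂, hp.of_append_right.of_append_left, fun a ha => by
      simp [Walk.mem_support_append_iff, ha], hk⟩
  · have hx : x ∉ r₃.support := by
      intro h
      have h1 : x = u := eq_of_mem_of_isPath_append hp (Walk.start_mem_support _)
        ((Walk.mem_support_append_iff _ _).2 (Or.inr h))
      subst h1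
      exact huv (eq_of_mem_of_isPath_append hp.of_append_right (Walk.start_mem_support _) h)
    have hy : y ∉ r₁.support := by
      intro h
      have h1 : y = u := eq_of_mem_of_isPath_append hp h (Walk.end_mem_support _)
      subst h1
      exact huv (eq_of_mem_of_isPath_append hp.of_append_right (Walk.start_mem_support _)
        (Walk.end_mem_support _))
    have := isPath_detour (a := Walk.cons hxy Walk.nil) hp huv
      (by simp [hxy.ne]) (by intro w hw; aesop) (by intro w hw; aesop)
    refine ⟨_, this, ?_, ?_⟩
    · intro w hw
      simp only [Walk.mem_support_append_iff, Walk.support_reverse, List.mem_reverse,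
        Walk.support_cons, Walk.support_nil, List.mem_cons, List.not_mem_nil, or_false] at hw ⊢
      rcases hw with h | (rfl | rfl) | h
      · exact Or.inl h
      · exact Or.inl (Walk.start_mem_support _)
      · exact Or.inr (Or.inr (Walk.end_mem_support _))
      · exact Or.inr (Or.inr h)
    · simp only [Walk.length_append, Walk.length_reverse, Walk.length_cons, Walk.length_nil] at he ⊢
      grind

/-- Adding an ear. -/
lemma JoinedByBothParities.union_ear {Z : Set V} (hZ : JoinedByBothParities K Z) {x y : V}
    (hx : x ∈ Z) (hy : y ∈ Z) (hxy : x ≠ y) {r : K.Walk x y} (hr : r.IsPath)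
    (hrZ : ∀ a ∈ r.support, a ∈ Z → a = x ∨ a = y) :
    JoinedByBothParities K (Z ∪ {a | a ∈ r.support}) := by
  -- one end on the ear, the other in the old part
  have key : ∀ {x y : V}, x ∈ Z → y ∈ Z → x ≠ y → ∀ {r : K.Walk x y}, r.IsPath →
      (∀ a ∈ r.support, a ∈ Z → a = x ∨ a = y) → ∀ u ∈ r.support, u ∉ Z → ∀ v ∈ Z, v ≠ x →
      ∀ k : ℕ, ∃ p : K.Walk u v, p.IsPath ∧ (∀ a ∈ p.support, a ∈ Z ∪ {a | a ∈ r.support}) ∧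
        Even (p.length + k) := by
    intro x y hx hy hxy r hr hrZ u hu huZ v hv hvx k
    obtain ⟨r₁, r₂, rfl⟩ := r.mem_support_iff_exists_append.mp hu
    obtain ⟨q, hq, hqZ, hk⟩ := hZ x hx v hv hvx.symm (r₁.length + k)
    refine ⟨r₁.reverse.append q, isPath_append_of_inter hr.of_append_left.reverse hq ?_, ?_, ?_⟩
    · intro a ha haq
      have ha1 : a ∈ r₁.support := by simpa using ha
      refine (hrZ a ((Walk.mem_support_append_iff _ _).2 (Or.inl ha1)) (hqZ a haq)).resolve_right ?_
      rintro rfl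
      exact huZ (eq_of_mem_of_isPath_append hr ha1 (Walk.end_mem_support _) ▸ hy)
    · intro a ha
      simp only [Walk.mem_support_append_iff, Walk.support_reverse, List.mem_reverse] at ha
      rcases ha with h | h
      · exact Or.inr ((Walk.mem_support_append_iff _ _).2 (Or.inl h))
      · exact Or.inl (hqZ a h)
    · simp only [Walk.length_append, Walk.length_reverse]
      grind
  have key1 : ∀ u ∈ r.support, u ∉ Z → ∀ v ∈ Z, ∀ k : ℕ, ∃ p : K.Walk u v, p.IsPath ∧
      (∀ a ∈ p.support, a ∈ Z ∪ {a | a ∈ r.support}) ∧ Even (p.length + k) := by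
    intro u hu huZ v hv k
    by_cases hvx : v = x
    · subst hvx
      have := key hy hx hxy.symm (r := r.reverse) hr.reverse
        (fun a ha haZ => (hrZ a (by simpa using ha) haZ).symm) u (by simpa using hu) huZ v hv hxy k
      simpa using this
    · exact key hx hy hxy hr hrZ u hu huZ v hv hvx k
  have key2 : ∀ u ∉ Z, ∀ v ∉ Z, u ≠ v → (∃ (r₁ : K.Walk x u) (r₂ : K.Walk u v) (r₃ : K.Walk v y),
      r = r₁.append (r₂.append r₃)) → ∀ k : ℕ, ∃ p : K.Walk u v, p.IsPath ∧
      (∀ a ∈ p.support, a ∈ Z ∪ {a | a ∈ r.support}) ∧ Even (p.length + k) := by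
    rintro u hu v hv huv ⟨r₁, r₂, r₃, rfl⟩ k
    -- Replace the middle piece of the ear by a route through `Z`, whose parity is free.
    obtain ⟨a, ha, haZ, hk⟩ := hZ x hx y hy hxy (r₁.length + r₃.length + k)
    refine ⟨_, isPath_detour hr huv ha ?_ ?_, ?_, ?_⟩
    · intro w hw hw1
      refine (hrZ w ((Walk.mem_support_append_iff _ _).2 (Or.inl hw1)) (haZ w hw)).resolve_right ?_
      rintro rfl
      exact hu (eq_of_mem_of_isPath_append hr hw1 (Walk.end_mem_support _) ▸ hy)
    · intro w hw hw3
      refine (hrZ w (by simp [Walk.mem_support_append_iff, hw3]) (haZ w hw)).resolve_left ?_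
      rintro rfl
      exact hu (eq_of_mem_of_isPath_append hr (Walk.start_mem_support _)
        ((Walk.mem_support_append_iff _ _).2 (Or.inr hw3)) ▸ hx)
    · intro w hw
      simp only [Walk.mem_support_append_iff, Walk.support_reverse, List.mem_reverse] at hw
      rcases hw with h | h | h
      · exact Or.inr (by simp [Walk.mem_support_append_iff, h])
      · exact Or.inl (haZ w h)
      · exact Or.inr (by simp [Walk.mem_support_append_iff, h])
    · simp only [Walk.length_append, Walk.length_reverse]
      grind
  intro u hu v hv huv k
  by_cases huZ : u ∈ Z <;> by_cases hvZ : v ∈ Z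
  · obtain ⟨p, hp, hs, hk⟩ := hZ u huZ v hvZ huv k
    exact ⟨p, hp, fun a ha => Or.inl (hs a ha), hk⟩
  · obtain ⟨p, hp, hs, hk⟩ := key1 v (hv.resolve_left hvZ) hvZ u huZ k
    exact ⟨p.reverse, hp.reverse, fun a ha => hs a (by simpa using ha), by simpa using hk⟩
  · exact key1 u (hu.resolve_left huZ) huZ v hvZ k
  · rcases exists_append_append r (hu.resolve_left huZ) (hv.resolve_left hvZ) with h | h
    · exact key2 u huZ v hvZ huv h k
    · obtain ⟨p, hp, hs, hk⟩ := key2 v hvZ u huZ huv.symm h k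
      exact ⟨p.reverse, hp.reverse, fun a ha => hs a (by simpa using ha), by simpa using hk⟩

/-- The initial segment of a walk up to its first vertex in a given set. -/
lemma exists_isPath_to_first_mem [DecidableEq V] {Z : Set V} {u v : V} (w : K.Walk u v)
    (hv : v ∈ Z) : ∃ y ∈ Z, ∃ q : K.Walk u y, q.IsPath ∧ (∀ a ∈ q.support, a ∈ w.support) ∧
      ∀ a ∈ q.support, a ∈ Z → a = y := by
  induction w with
  | nil => exact ⟨_, hv, Walk.nil, by simp, by simp, by simp⟩
  | @cons a b c h w ih =>
    by_cases ha : a ∈ Z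
    · exact ⟨a, ha, Walk.nil, by simp, by simp, by simp⟩
    obtain ⟨y, hy, q, hq, hqw, hqZ⟩ := ih hv
    refine ⟨y, hy, (Walk.cons h q).bypass, Walk.bypass_isPath _, ?_, ?_⟩
    · intro d hd
      have := Walk.support_bypass_subset_support _ hd
      simp only [Walk.support_cons, List.mem_cons] at this ⊢
      exact this.imp_right (hqw d)
    · intro d hd hdZ
      have := Walk.support_bypass_subset_support _ hd
      simp only [Walk.support_cons, List.mem_cons] at this
      rcases this with rfl | h
      · exact absurd hdZ ha
      · exact hqZ d h hdZ

/-- In a nonbipartite graph without cutvertices, any two vertices are joined by paths of both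
parities. -/
theorem joinedByBothParities_univ [Finite V] (hconn : K.Preconnected)
    (hcut : ∀ v x y : V, x ≠ v → y ≠ v → ∃ p : K.Walk x y, v ∉ p.support)
    (hodd : ¬ K.Colorable 2) : JoinedByBothParities K Set.univ := by
  classical
  obtain ⟨x, y, hxy, p, hp, he⟩ := exists_even_path_of_adj hodd
  obtain ⟨Z, hle, hZ⟩ := Set.Finite.exists_le_maximal (s := {Z : Set V | JoinedByBothParities K Z})
    (Set.toFinite _) (joinedByBothParities_of_even_path hxy hp he)
  suffices Z = Set.univ from this ▸ hZ.prop
  by_contra hne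
  obtain ⟨w, hw⟩ := (Set.ne_univ_iff_exists_notMem Z).mp hne
  have hxZ : x ∈ Z := hle (Walk.start_mem_support _)
  have hyZ : y ∈ Z := hle (Walk.end_mem_support _)
  obtain ⟨q⟩ := hconn x w
  obtain ⟨d, -, hd1, hd2⟩ := q.exists_boundary_dart Z hxZ hw
  obtain ⟨⟨z, z'⟩, hadj⟩ := d
  simp only at hd1 hd2
  obtain ⟨z₁, hz₁, hne₁⟩ : ∃ z₁ ∈ Z, z₁ ≠ z := by
    by_cases h : x = z
    · exact ⟨y, hyZ, h ▸ hxy.ne'⟩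
    · exact ⟨x, hxZ, h⟩
  -- As `z` is no cutvertex, the edge leaving `Z` extends to an ear that returns to `Z` at another
  -- vertex.
  obtain ⟨s, hs⟩ := hcut z z' z₁ (by rintro rfl; exact hd2 hd1) hne₁
  obtain ⟨z₂, hz₂, q', hq', hsub, hfirst⟩ := exists_isPath_to_first_mem s hz₁
  have hzq : z ∉ q'.support := fun h => hs (hsub _ h)
  have hz2 : z ≠ z₂ := by
    rintro rfl
    exact hzq (Walk.end_mem_support _)
  have hear := hZ.prop.union_ear hd1 hz₂ hz2 (r := Walk.cons hadj q') (hq'.cons hzq) (by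
    intro a ha haZ
    simp only [Walk.support_cons, List.mem_cons] at ha
    exact ha.imp_right fun h => hfirst a h haZ)
  have := hZ.le_of_ge (y := Z ∪ {a | a ∈ (Walk.cons hadj q').support}) hear Set.subset_union_left
  exact hd2 (this (Or.inr (by simp)))

end Walks

/-! ### From matchings in the prism to disjoint parity-breaking paths -/

section Packing

variable {V : Type*} {G : SimpleGraph V} {C : Set V} {b : V → Bool}

/-- A `C`-path that breaks the parity prescribed by the colouring `b`. -/
def BreaksParity (C : Set V) (b : V → Bool) {u v : V} (p : G.Walk u v) : Prop :=
  p.IsPath ∧ u ∈ C ∧ v ∈ C ∧ u ≠ v ∧ (b u = b v ↔ Odd p.length)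

/-- An involution of `V × Bool` that encodes a matching in the part of the prism over `G` that has
only the copy `(c, b c)` of each vertex `c` of `C`, such that only vertices over `C` are exposed. -/
structure IsPrismMatching (G : SimpleGraph V) (C : Set V) (b : V → Bool)
    (m : V × Bool → V × Bool) : Prop where
  invol : ∀ x, m (m x) = x
  ne_self : ∀ x, x.1 ∉ C → m x ≠ x
  fixed : ∀ c ∈ C, m (c, !b c) = (c, !b c)
  adj : ∀ x, (m x).1 = x.1 ∨ (G.Adj x.1 (m x).1 ∧ (m x).2 = x.2)

/-- Alternate between matching edges and rungs. The path `p` has arrived at `v` on level `i` and is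
about to leave from `(v, !i)`, the only element over `p` whose mate may lie elsewhere; the level
records the parity of the length. The number `n` bounds the remaining steps. Since the final path is
closed under `m`, it can be deleted before the next path is sought. -/
lemma IsPrismMatching.exists_walk [Finite V] {m : V × Bool → V × Bool}
    (hm : IsPrismMatching G C b m) {A : Set V} (hA : ∀ x, x.1 ∈ A → (m x).1 ∈ A) {c : V}
    (hc : c ∈ C) (n : ℕ) :
    ∀ (v : V) (p : G.Walk c v) (i : Bool), p.IsPath → Nat.card V ≤ n + p.length →
      (∀ a ∈ p.support, a ∈ A) → (∀ a ∈ p.support, a ∈ C → a = c) → m (v, !i) ≠ (v, !i) →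
      (∀ x, x.1 ∈ p.support → x ≠ (v, !i) → (m x).1 ∈ p.support ∧ m x ≠ (v, !i)) →
      (i = b c ↔ Odd p.length) →
      ∃ (w : V) (q : G.Walk c w), BreaksParity C b q ∧ (∀ a ∈ q.support, a ∈ A) ∧
        (∀ a ∈ q.support, a ∈ C → a = c ∨ a = w) ∧ ∀ x, x.1 ∈ q.support → (m x).1 ∈ q.support := by
  induction n with
  | zero =>
    intro v p i hp hn
    cases nonempty_fintype V
    have := hp.length_lt
    rw [Nat.card_eq_fintype_card] at hn
    omega
  | succ n ih =>
    intro v p i hp hn hpA hpC hne hQ hpar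
    have hw : (m (v, !i)).1 ∉ p.support := by
      intro h
      have := hQ _ h hne
      rw [hm.invol] at this
      exact this.2 rfl
    have hwA : (m (v, !i)).1 ∈ A := hA _ (hpA _ (Walk.end_mem_support _))
    have hv : (m (v, !i)).1 ≠ v := fun h => hw (by rw [h]; exact Walk.end_mem_support _)
    obtain ⟨hadj, hlev⟩ := (hm.adj (v, !i)).resolve_left hv
    obtain ⟨w, hmw⟩ : ∃ w, m (v, !i) = (w, !i) := ⟨_, Prod.ext rfl hlev⟩
    rw [hmw] at hw hwA hadj
    simp only at hw hwA hadj
    have hmv : m (w, !i) = (v, !i) := by rw [← hmw, hm.invol]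
    have hq : (p.concat hadj).IsPath := hp.concat hw hadj
    have hsupp : ∀ a, a ∈ (p.concat hadj).support ↔ a ∈ p.support ∨ a = w := by
      simp [Walk.support_concat]
    have hqA : ∀ a ∈ (p.concat hadj).support, a ∈ A := by
      intro a ha
      rcases (hsupp a).1 ha with h | rfl
      exacts [hpA a h, hwA]
    have hcl : ∀ x, x.1 ∈ p.support → (m x).1 ∈ (p.concat hadj).support := by
      intro x hx
      rw [hsupp]
      by_cases h : x = (v, !i)
      · exact Or.inr (by rw [h, hmw])
      · exact Or.inl (hQ x hx h).1
    by_cases hwC : w ∈ C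
    · have hbw : b w = !i := by
        by_contra hb
        have h1 := hm.fixed w hwC
        have h2 : (!b w) = !i := by revert hb; cases b w <;> cases i <;> simp
        rw [h2, hmv] at h1
        exact hadj.ne (congrArg Prod.fst h1)
      refine ⟨w, p.concat hadj, ⟨hq, hc, hwC, ?_, ?_⟩, hqA, ?_, ?_⟩
      · rintro rfl
        exact hw (Walk.start_mem_support _)
      · rw [Walk.length_concat, Nat.odd_add_one, ← hpar, hbw]
        cases b c <;> cases i <;> simp
      · intro a ha haC
        exact ((hsupp a).1 ha).imp_left fun h => hpC a h haC
      · rintro ⟨x, j⟩ hx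
        rcases (hsupp _).1 hx with h | h
        · exact hcl _ h
        · simp only at h
          subst h
          by_cases hj : j = !i
          · rw [hj, hmv]
            exact (hsupp _).2 (Or.inl (Walk.end_mem_support _))
          · have : j = !b x := by rw [hbw]; revert hj; cases j <;> cases i <;> simp
            rw [this, hm.fixed _ hwC]
            exact (hsupp _).2 (Or.inr rfl)
    · refine ih w (p.concat hadj) (!i) hq ?_ hqA ?_ (hm.ne_self _ hwC) ?_ ?_
      · rw [Walk.length_concat]; omega
      · intro a ha haC
        rcases (hsupp a).1 ha with h | rfl
        exacts [hpC a h haC, absurd haC hwC]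
      · rintro ⟨x, j⟩ hx hxne
        have hnot : ∀ y : V × Bool, (m y).1 ∈ p.support → m y ≠ (w, !!i) := by
          intro y hy h
          rw [h] at hy
          exact hw hy
        rcases (hsupp _).1 hx with h | h
        · refine ⟨hcl _ h, ?_⟩
          by_cases hxv : (x, j) = (v, !i)
          · rw [hxv, hmw]; simp
          · exact hnot _ (hQ _ h hxv).1
        · simp only at h
          subst h
          have : j = !i := by revert hxne; cases j <;> cases i <;> simp
          rw [this, hmv]
          refine ⟨(hsupp _).2 (Or.inl (Walk.end_mem_support _)), ?_⟩
          exact fun h => hadj.ne (congrArg Prod.fst h)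
      · rw [Walk.length_concat, Nat.odd_add_one, ← hpar]
        cases b c <;> cases i <;> simp

lemma IsPrismMatching.exists_paths [Finite V] {m : V × Bool → V × Bool}
    (hm : IsPrismMatching G C b m) (l : ℕ) :
    ∀ A : Set V, (∀ x, x.1 ∈ A → (m x).1 ∈ A) →
      2 * l ≤ {x : V × Bool | x.1 ∈ A ∧ x.1 ∈ C ∧ m x ≠ x}.ncard →
      ∃ P : Fin l → Σ e : V × V, G.Walk e.1 e.2, (∀ i, BreaksParity C b (P i).2) ∧
        (∀ i, ∀ a ∈ (P i).2.support, a ∈ A) ∧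
        ∀ i j, i ≠ j → (P i).2.support.Disjoint (P j).2.support := by
  induction l with
  | zero => exact fun A _ _ => ⟨Fin.elim0, fun i => i.elim0, fun i => i.elim0, fun i => i.elim0⟩
  | succ l ih =>
    intro A hA hcard
    obtain ⟨⟨c, i⟩, hcA, hc, hci⟩ : {x : V × Bool | x.1 ∈ A ∧ x.1 ∈ C ∧ m x ≠ x}.Nonempty :=
      Set.nonempty_of_ncard_ne_zero (by omega)
    simp only at hcA hc
    have level : ∀ x ∈ {x : V × Bool | x.1 ∈ A ∧ x.1 ∈ C ∧ m x ≠ x}, x = (x.1, b x.1) := by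
      rintro ⟨x, j⟩ ⟨-, hx, hxj⟩
      have : j ≠ !b x := by
        rintro rfl
        exact hxj (hm.fixed x hx)
      revert this
      cases j <;> cases b x <;> simp
    have hcb : i = b c := congrArg Prod.snd (level (c, i) ⟨hcA, hc, hci⟩)
    subst hcb
    -- The trivial path counts as having arrived on level `!b c`, so that it leaves on level `b c`.
    obtain ⟨w, q, hq, hqA, hqC, hqcl⟩ := hm.exists_walk hA hc (Nat.card V) c Walk.nil (!b c)
      (by simp) (by simp) (by simpa using hcA) (by simp) (by simpa using hci) (by
        rintro ⟨x, j⟩ hx hxj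
        simp only [Walk.support_nil, List.mem_singleton] at hx
        subst hx
        have : j = !b x := by revert hxj; cases j <;> cases b x <;> simp
        rw [this, hm.fixed _ hc]
        simp) (by simp)
    have hA' : ∀ x : V × Bool, x.1 ∈ A \ {a | a ∈ q.support} → (m x).1 ∈ A \ {a | a ∈ q.support} := by
      rintro x ⟨hx, hxq⟩
      refine ⟨hA x hx, fun h => hxq ?_⟩
      have := hqcl (m x) h
      rwa [hm.invol] at this
    have hcard' : 2 * l ≤ {x : V × Bool | x.1 ∈ A \ {a | a ∈ q.support} ∧ x.1 ∈ C ∧ m x ≠ x}.ncard := by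
      -- A path uses up at most two matched copies, those at its ends.
      have hsub : {x : V × Bool | x.1 ∈ A ∧ x.1 ∈ C ∧ m x ≠ x} ⊆
          {x : V × Bool | x.1 ∈ A \ {a | a ∈ q.support} ∧ x.1 ∈ C ∧ m x ≠ x} ∪
            {(c, b c), (w, b w)} := by
        intro x hx
        by_cases hxq : x.1 ∈ q.support
        · right
          have := level x hx
          rcases hqC _ hxq hx.2.1 with h | h <;> rw [this, h] <;> simp
        · exact Or.inl ⟨⟨hx.1, hxq⟩, hx.2⟩
      have h1 := Set.ncard_le_ncard hsub (Set.toFinite _)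
      have h2 := Set.ncard_union_le
        {x : V × Bool | x.1 ∈ A \ {a | a ∈ q.support} ∧ x.1 ∈ C ∧ m x ≠ x} {(c, b c), (w, b w)}
      have h3 := Set.ncard_insert_le (c, b c) {(w, b w)}
      rw [Set.ncard_singleton] at h3
      omega
    obtain ⟨P, hP, hPA, hPd⟩ := ih _ hA' hcard'
    refine ⟨Fin.cons ⟨(c, w), q⟩ P, ?_, ?_, ?_⟩
    · intro i
      refine Fin.cases ?_ (fun i => ?_) i
      · exact hq
      · exact hP i
    · intro i
      refine Fin.cases ?_ (fun i => ?_) i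
      · exact hqA
      · exact fun a ha => (hPA i a ha).1
    · intro i j
      refine Fin.cases ?_ (fun i => ?_) i <;> refine Fin.cases ?_ (fun j => ?_) j
      · simp
      · intro _ a ha ha'
        exact (hPA j a ha').2 ha
      · intro _ a ha ha'
        exact (hPA i a ha).2 ha'
      · intro h
        exact hPd i j (by simpa using h)

end Packing

/-! ### The augmented prism and tracing paths through its components -/

section Prism

variable {V : Type*} {G : SimpleGraph V} {C : Set V} {b : V → Bool}

/-- Adjacency in the prism over `G`, in which the copy `(c, !b c)` of a vertex `c` of `C` is made
isolated. -/
def PrismAdj (G : SimpleGraph V) (C : Set V) (b : V → Bool) (x y : V × Bool) : Prop :=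
  (x.1 = y.1 ∧ x.2 ≠ y.2 ∧ x.1 ∉ C) ∨
    (G.Adj x.1 y.1 ∧ x.2 = y.2 ∧ (x.1 ∈ C → x.2 = b x.1) ∧ (y.1 ∈ C → y.2 = b y.1))

lemma PrismAdj.symm {x y : V × Bool} (h : PrismAdj G C b x y) : PrismAdj G C b y x := by
  rcases h with ⟨h1, h2, h3⟩ | ⟨h1, h2, h3, h4⟩
  · exact Or.inl ⟨h1.symm, h2.symm, h1 ▸ h3⟩
  · exact Or.inr ⟨h1.symm, h2.symm, h4, h3⟩

/-- The prism together with a clique `W` that is joined to all copies of vertices of `C`. -/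
def augmentedPrism (G : SimpleGraph V) (C : Set V) (b : V → Bool) (W : Type*) :
    SimpleGraph ((V × Bool) ⊕ W) where
  Adj
    | .inl x, .inl y => PrismAdj G C b x y
    | .inl x, .inr _ => x.1 ∈ C
    | .inr _, .inl y => y.1 ∈ C
    | .inr i, .inr j => i ≠ j
  symm := ⟨by
    rintro (x | i) (y | j) h
    exacts [PrismAdj.symm h, h, h, Ne.symm h]⟩
  loopless := ⟨by
    rintro (x | i) h
    · rcases h with ⟨-, h, -⟩ | ⟨h, -⟩
      exacts [h rfl, G.loopless.irrefl _ h]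
    · exact h rfl⟩

lemma ncard_prod_bool [Finite V] (C : Set V) : {x : V × Bool | x.1 ∈ C}.ncard = 2 * C.ncard := by
  have : {x : V × Bool | x.1 ∈ C} = C ×ˢ Set.univ := by ext; simp
  rw [this, Set.ncard_prod, Set.ncard_univ]
  simp [mul_comm]

lemma exists_paths_of_isPerfectMatching [Finite V] {l d : ℕ} (hd : d + 2 * l = 2 * C.ncard)
    {M : (augmentedPrism G C b (Fin d)).Subgraph} (hM : M.IsPerfectMatching) :
    ∃ P : Fin l → Σ e : V × V, G.Walk e.1 e.2, (∀ i, BreaksParity C b (P i).2) ∧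
      ∀ i j, i ≠ j → (P i).2.support.Disjoint (P j).2.support := by
  classical
  rw [Subgraph.isPerfectMatching_iff] at hM
  choose f hf hfu using hM
  simp only at hfu
  have hff : ∀ x, f (f x) = x := fun x => (hfu _ _ (hf x).symm).symm
  have hadj : ∀ x, (augmentedPrism G C b (Fin d)).Adj x (f x) := fun x => M.adj_sub (hf x)
  -- Elements matched into the clique become fixed points.
  let m : V × Bool → V × Bool := fun x => Sum.elim id (fun _ => x) (f (.inl x))
  have hml : ∀ {x y}, f (.inl x) = .inl y → m x = y := fun h => by simp [m, h]
  have hmr : ∀ {x i}, f (.inl x) = .inr i → m x = x := fun h => by simp [m, h]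
  have hl : ∀ {x y}, f (.inl x) = .inl y → PrismAdj G C b x y := fun {x y} h => by
    have := hadj (.inl x)
    rwa [h] at this
  have hm : IsPrismMatching G C b m := by
    refine ⟨fun x => ?_, fun x hx => ?_, fun c hc => ?_, fun x => ?_⟩
    · rcases h : f (.inl x) with y | i
      · rw [hml h]
        exact hml (by rw [← h, hff])
      · rw [hmr h, hmr h]
    · rcases h : f (.inl x) with y | i
      · rw [hml h]
        rintro rfl
        rcases hl h with ⟨-, h, -⟩ | ⟨h, -⟩
        exacts [h rfl, G.loopless.irrefl _ h]
      · have := hadj (.inl x)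
        rw [h] at this
        exact absurd this hx
    · rcases h : f (.inl (c, !b c)) with y | i
      · rcases hl h with ⟨-, -, h⟩ | ⟨-, -, h, -⟩
        · exact absurd hc h
        · have := h hc
          simp at this
      · exact hmr h
    · rcases h : f (.inl x) with y | i
      · rw [hml h]
        rcases hl h with ⟨h, -, -⟩ | ⟨h, h', -, -⟩
        exacts [Or.inl h.symm, Or.inr ⟨h, h'.symm⟩]
      · exact Or.inl (by rw [hmr h])
  have hcount : 2 * l ≤ {x : V × Bool | x.1 ∈ (Set.univ : Set V) ∧ x.1 ∈ C ∧ m x ≠ x}.ncard := by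
    have h1 : {x : V × Bool | x.1 ∈ C} ⊆
        {x : V × Bool | x.1 ∈ (Set.univ : Set V) ∧ x.1 ∈ C ∧ m x ≠ x} ∪
          {x : V × Bool | x.1 ∈ C ∧ m x = x} := by
      intro x hx
      by_cases h : m x = x
      · exact Or.inr ⟨hx, h⟩
      · exact Or.inl ⟨trivial, hx, h⟩
    -- Fixed copies over `C` have distinct partners in the clique, so there are at most `d` of them.
    have h2 : {x : V × Bool | x.1 ∈ C ∧ m x = x}.ncard ≤
        (Set.range (Sum.inr : Fin d → (V × Bool) ⊕ Fin d)).ncard := by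
      refine Set.ncard_le_ncard_of_injOn (fun x => f (.inl x)) ?_ ?_ (Set.toFinite _)
      · rintro x ⟨hx, hxm⟩
        rcases h : f (.inl x) with y | i
        · rw [hml h] at hxm
          have := hadj (.inl x)
          rw [h, hxm] at this
          exact absurd this (SimpleGraph.irrefl _)
        · simp
      · intro x _ y _ h
        have := congrArg f h
        simpa [hff] using this
    have h3 := Set.ncard_le_ncard h1 (Set.toFinite _)
    have h4 := Set.ncard_union_le
      {x : V × Bool | x.1 ∈ (Set.univ : Set V) ∧ x.1 ∈ C ∧ m x ≠ x}
      {x : V × Bool | x.1 ∈ C ∧ m x = x}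
    have h5 : (Set.range (Sum.inr : Fin d → (V × Bool) ⊕ Fin d)).ncard = d := by
      rw [← Set.image_univ, Set.ncard_image_of_injective _ Sum.inr_injective, Set.ncard_univ]
      simp
    rw [ncard_prod_bool] at h3
    omega
  obtain ⟨P, hP, -, hPd⟩ := hm.exists_paths l Set.univ (by simp) hcount
  exact ⟨P, hP, hPd⟩

/-- The elements outside of `S` that are copies of a vertex of `C` or whose twin lies in `S`. -/
def lonely (C : Set V) (S : Set (V × Bool)) : Set (V × Bool) :=
  {x | x ∉ S ∧ (x.1 ∈ C ∨ (x.1, !x.2) ∈ S)}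

/-- The vertices of `C` with some copy in `S` and the other vertices with both copies in `S`. -/
def blocked (C : Set V) (S : Set (V × Bool)) : Set V :=
  {v | (v ∈ C → (v, true) ∈ S ∨ (v, false) ∈ S) ∧ (v ∉ C → (v, true) ∈ S ∧ (v, false) ∈ S)}

lemma ncard_eq_sum_bool [Fintype V] (s : Set (V × Bool)) [DecidablePred (· ∈ s)] :
    s.ncard = ∑ v : V, ((if (v, true) ∈ s then 1 else 0) + (if (v, false) ∈ s then 1 else 0)) := by
  rw [Set.ncard_eq_toFinset_card', ← Set.filter_mem_univ_eq_toFinset, Finset.card_filter,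
    Fintype.sum_prod_type]
  simp only [Fintype.sum_bool]

/-- The inequality holds separately over each vertex of `V`, where a vertex of `C` contributes an
extra 2 on the right. -/
lemma two_mul_ncard_blocked_add_ncard_lonely_le [Finite V] (C : Set V) (S : Set (V × Bool)) :
    2 * (blocked C S).ncard + (lonely C S).ncard ≤ S.ncard + 2 * C.ncard := by
  classical
  cases nonempty_fintype V
  have h : ∀ t : Set V, t.ncard = ∑ v : V, if v ∈ t then 1 else 0 := by
    intro t
    rw [Set.ncard_eq_toFinset_card', ← Set.filter_mem_univ_eq_toFinset, Finset.card_filter]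
  rw [ncard_eq_sum_bool S, ncard_eq_sum_bool (lonely C S), h, h, Finset.mul_sum, Finset.mul_sum,
    ← Finset.sum_add_distrib, ← Finset.sum_add_distrib]
  refine Finset.sum_le_sum fun v _ => ?_
  by_cases h1 : v ∈ C <;> by_cases h2 : (v, true) ∈ S <;> by_cases h3 : (v, false) ∈ S <;>
    simp [blocked, lonely, h1, h2, h3]

/-- Following a walk through the levels of the prism: if the classes of `κ` are unions of components
of the prism minus `S` and every class has at most one lonely element that is not over `X`, then
no walk that avoids `X` can reach a vertex of `C`. -/
lemma false_of_isPath {ι : Type*} {S : Set (V × Bool)} {X : Set V} (hX : blocked C S ⊆ X)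
    (κ : V × Bool → ι) (hκ : ∀ x y, x ∉ S → y ∉ S → PrismAdj G C b x y → κ x = κ y)
    (huniq : ∀ x ∈ lonely C S, ∀ y ∈ lonely C S, κ x = κ y → x.1 ∉ X → y.1 ∉ X → x = y)
    {v w : V} (p : G.Walk v w) : p.IsPath → (∀ a ∈ p.support, a ∉ X) → w ∈ C →
      ∀ (i : Bool) (t : V × Bool), (v ∈ C → i = b v) → (v, i) ∉ S → κ (v, i) = κ t →
      t ∈ lonely C S → t.1 ∉ X → t.1 ∉ p.support.tail → (i = b w ↔ Odd p.length) →
      0 < p.length → False := by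
  induction p with
  | nil => simp
  | @cons v v' w h p ih =>
    intro hp hpX hwC i t hvi hviS hκt ht htX htp hpar _
    rw [Walk.cons_isPath_iff] at hp
    rw [Walk.support_cons, List.tail_cons] at htp
    have hv'X : v' ∉ X := hpX v' (by simp)
    have hpX' : ∀ a ∈ p.support, a ∉ X := fun a ha => hpX a (by simp [ha])
    have htv' : t.1 ≠ v' := fun h => htp (by rw [h]; exact Walk.start_mem_support _)
    have hnodup : v' ∉ p.support.tail := by
      have := hp.1.support_nodup
      rw [← Walk.cons_tail_support] at this
      exact (List.nodup_cons.mp this).1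
    have hpar' : (!i) = b w ↔ Odd p.length := by
      rw [Walk.length_cons, Nat.odd_add_one] at hpar
      rw [← not_iff_not, ← hpar]
      cases i <;> cases b w <;> simp
    have hblock : v' ∉ blocked C S := fun h => hv'X (hX h)
    -- `t` is the last lonely element met, and its class has been followed up to `(v, i)`. A lonely
    -- `(v', i)` would be a second one in this class.
    have hlast : (v' ∈ C → i = b v') → (v', i) ∉ lonely C S := by
      intro hi hl
      have hadj : PrismAdj G C b (v, i) (v', i) := Or.inr ⟨h, rfl, hvi, hi⟩
      have := huniq t ht _ hl (hκt ▸ hκ _ _ hviS hl.1 hadj) htX hv'X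
      exact htv' (congrArg Prod.fst this)
    -- If the lift cannot be continued but `(v', !i)` is lonely, the tracing starts afresh there.
    have hrestart : (v' ∈ C → (!i) = b v') → (v', !i) ∈ lonely C S → 0 < p.length → False :=
      fun hi hl hpos => ih hp.1 hpX' hwC (!i) (v', !i) hi hl.1 rfl hl hv'X hnodup hpar' hpos
    have hlen : p.length = 0 → v' = w := Walk.eq_of_length_eq_zero
    by_cases hC : v' ∈ C
    · simp only [blocked, Set.mem_ofPred_eq, hC, not_true_eq_false, forall_const, IsEmpty.forall_iff,
        and_true, not_or] at hblock
      have hl : ∀ j, (v', j) ∈ lonely C S := by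
        rintro (_ | _)
        exacts [⟨hblock.2, Or.inl hC⟩, ⟨hblock.1, Or.inl hC⟩]
      by_cases hi : i = b v'
      · exact hlast (fun _ => hi) (hl i)
      -- The walk cannot end here, since parity forces its last edge to have level `b w`.
      · refine hrestart (fun _ => ?_) (hl _) (Nat.pos_of_ne_zero fun h0 => ?_)
        · revert hi; cases i <;> cases b v' <;> simp
        · rw [Walk.length_cons, h0, ← hlen h0] at hpar
          exact hi (hpar.2 (by simp))
    · have hpos : 0 < p.length := Nat.pos_of_ne_zero fun h0 => hC (hlen h0 ▸ hwC)
      simp only [blocked, Set.mem_ofPred_eq, hC, not_false_eq_true, forall_const, IsEmpty.forall_iff,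
        true_and] at hblock
      have hnot : (v', i) ∈ S → (v', !i) ∉ S := by
        intro h1 h2
        cases i
        exacts [hblock ⟨h2, h1⟩, hblock ⟨h1, h2⟩]
      by_cases h1 : (v', i) ∈ S
      · exact hrestart (fun h => absurd h hC) ⟨hnot h1, Or.inr (by simpa using h1)⟩ hpos
      by_cases h2 : (v', !i) ∈ S
      · exact hlast (fun h => absurd h hC) ⟨h1, Or.inr h2⟩
      -- Both copies of `v'` survive: cross the rung within the same class and keep `t`.
      · have e1 : κ (v, i) = κ (v', i) :=
          hκ _ _ hviS h1 (Or.inr ⟨h, rfl, hvi, fun h => absurd h hC⟩)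
        have e2 : κ (v', i) = κ (v', !i) := hκ _ _ h1 h2 (Or.inl ⟨rfl, by simp, hC⟩)
        exact ih hp.1 hpX' hwC (!i) t (fun h => absurd h hC) h2 (by rw [← e2, ← e1, hκt]) ht htX
          (fun h => htp (List.mem_of_mem_tail h)) hpar' hpos

lemma not_breaksParity {ι : Type*} {S : Set (V × Bool)} {X : Set V} (hX : blocked C S ⊆ X)
    (κ : V × Bool → ι) (hκ : ∀ x y, x ∉ S → y ∉ S → PrismAdj G C b x y → κ x = κ y)
    (huniq : ∀ x ∈ lonely C S, ∀ y ∈ lonely C S, κ x = κ y → x.1 ∉ X → y.1 ∉ X → x = y)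
    {v w : V} {p : G.Walk v w} (hp : BreaksParity C b p) : ∃ a ∈ p.support, a ∈ X := by
  by_contra! hpX
  obtain ⟨hpath, hv, hw, hvw, hpar⟩ := hp
  have hvX : v ∉ X := hpX v (Walk.start_mem_support _)
  have hvS : (v, b v) ∉ S := by
    intro h
    refine hvX (hX ⟨fun _ => ?_, fun h => absurd hv h⟩)
    cases hb : b v <;> rw [hb] at h
    exacts [Or.inr h, Or.inl h]
  refine false_of_isPath hX κ hκ huniq p hpath hpX hw (b v) (v, b v) (fun _ => rfl) hvS rfl
    ⟨hvS, Or.inl hv⟩ hvX ?_ hpar (Nat.pos_of_ne_zero fun h => hvw (Walk.eq_of_length_eq_zero h))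
  have := hpath.support_nodup
  rw [← Walk.cons_tail_support] at this
  exact (List.nodup_cons.mp this).1

end Prism

/-! ### From Tutte violators to hitting sets -/

section Packing

variable {V : Type*} {G : SimpleGraph V} {C : Set V} {b : V → Bool}

/-- A component of odd size of the augmented prism minus `S` that avoids the clique `W` contains a
lonely element. -/
lemma exists_lonely_of_odd [Finite V] {W : Type*} [Finite W] {S : Set ((V × Bool) ⊕ W)}
    {K : ((⊤ : (augmentedPrism G C b W).Subgraph).deleteVerts S).coe.ConnectedComponent}
    (hK : Odd K.supp.ncard) (hW : ∀ x ∈ K.supp, ∀ i, x.1 ≠ .inr i) :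
    ∃ x ∈ K.supp, ∃ y : V × Bool, x.1 = .inl y ∧ y ∈ lonely C (Sum.inl ⁻¹' S) := by
  classical
  by_contra! hno
  let g : (V × Bool) ⊕ W → (V × Bool) ⊕ W := Sum.map (fun x => (x.1, !x.2)) id
  let T : Set ((V × Bool) ⊕ W) := Subtype.val '' K.supp
  -- Without lonely elements, exchanging twins is a fixed-point-free involution of the component, so
  -- its size is even.
  have hgT : ∀ a ∈ T, g a ∈ T ∧ g a ≠ a ∧ g (g a) = a := by
    rintro _ ⟨⟨x | i, hx⟩, hxK, rfl⟩
    · have hl : x ∉ lonely C (Sum.inl ⁻¹' S) := hno _ hxK x rfl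
      have hxS : x ∉ Sum.inl ⁻¹' S := by simpa using hx
      have hxC : x.1 ∉ C := fun h => hl ⟨hxS, Or.inl h⟩
      have hx' : (x.1, !x.2) ∉ Sum.inl ⁻¹' S := fun h => hl ⟨hxS, Or.inr h⟩
      refine ⟨⟨⟨.inl (x.1, !x.2), by simpa using hx'⟩, ?_, rfl⟩, ?_, ?_⟩
      · rw [ConnectedComponent.mem_supp_iff] at hxK ⊢
        rw [← hxK]
        refine ConnectedComponent.sound (Adj.reachable ?_)
        simp only [Subgraph.coe_adj, Subgraph.deleteVerts_adj, Subgraph.verts_top, Set.mem_univ,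
          true_and, Subgraph.top_adj]
        exact ⟨hx', hxS, Or.inl ⟨rfl, by simp, hxC⟩⟩
      · simp [g, Prod.ext_iff]
      · simp [g]
    · exact absurd rfl (hW _ hxK i)
  have hsum : ∑ _a ∈ T.toFinite.toFinset, (1 : ZMod 2) = 0 := by
    refine Finset.sum_involution (fun a _ => g a) ?_ ?_ ?_ ?_
    · intros; decide
    · intro a ha _
      exact (hgT a (by simpa using ha)).2.1
    · intro a ha
      simpa using (hgT a (by simpa using ha)).1
    · intro a ha
      exact (hgT a (by simpa using ha)).2.2
  rw [Finset.sum_const, nsmul_one, ZMod.natCast_eq_zero_iff_even,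
    ← Set.ncard_eq_toFinset_card, Set.ncard_image_of_injective _ Subtype.val_injective] at hsum
  exact Nat.not_even_iff_odd.2 hK hsum

lemma exists_hitting_set_of_isTutteViolator [Finite V] {l d : ℕ} (hd : d + 2 * l = 2 * C.ncard)
    {S : Set ((V × Bool) ⊕ Fin d)} (hS : (augmentedPrism G C b (Fin d)).IsTutteViolator S) :
    ∃ X : Set V, X.ncard ≤ 2 * l - 2 ∧
      ∀ (u v : V) (p : G.Walk u v), BreaksParity C b p → ∃ a ∈ p.support, a ∈ X := by
  classical
  unfold IsTutteViolator at hS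
  set D := ((⊤ : (augmentedPrism G C b (Fin d)).Subgraph).deleteVerts S) with hD
  have hadjD : ∀ x y (hx : x ∉ S) (hy : y ∉ S), (augmentedPrism G C b (Fin d)).Adj x y →
      D.coe.connectedComponentMk ⟨x, by simpa [D] using hx⟩ =
        D.coe.connectedComponentMk ⟨y, by simpa [D] using hy⟩ := by
    intro x y hx hy h
    refine ConnectedComponent.sound (Adj.reachable ?_)
    simp [D, hx, hy, h]
  have hmem : ∀ x : D.verts, x.1 ∉ S := fun x => by simpa [D] using x.2
  -- by parity, the violation is at least two
  have hpar : S.ncard + 2 ≤ D.coe.oddComponents.ncard := by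
    have h1 := D.coe.odd_ncard_oddComponents
    have h2 : Nat.card D.verts + S.ncard = 2 * Nat.card V + d := by
      have : D.verts = Sᶜ := by ext; simp [D]
      rw [this, Nat.card_coe_set_eq, add_comm, Set.ncard_add_ncard_compl]
      simp [mul_comm]
    grind
  -- If a clique vertex survives, its component `K₀` contains all surviving copies over `C`. Every
  -- other odd component then has a lonely element with its twin in `S`, so there are at most `|S| +
  -- 1` odd components, a contradiction.
  by_cases hW : ∃ i : Fin d, Sum.inr i ∉ S
  · exfalso
    obtain ⟨i, hi⟩ := hW
    set K₀ := D.coe.connectedComponentMk ⟨.inr i, by simpa [D] using hi⟩ with hK₀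
    have hrep : ∀ K : (D.coe.oddComponents \ {K₀} : Set _), ∃ x ∈ K.1.supp, ∃ y : V × Bool,
        x.1 = .inl y ∧ y ∈ lonely C (Sum.inl ⁻¹' S) ∧ y.1 ∉ C := by
      rintro ⟨K, hK, hne⟩
      have hne' : ∀ x ∈ K.supp, ¬ (augmentedPrism G C b (Fin d)).Adj x.1 (.inr i) := by
        intro x hx h
        rw [ConnectedComponent.mem_supp_iff] at hx
        exact hne (by rw [Set.mem_singleton_iff, ← hx]; exact hadjD _ _ (hmem x) hi h)
      obtain ⟨x, hx, y, hxy, hy⟩ := exists_lonely_of_odd hK (by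
        intro x hx j hj
        by_cases hij : j = i
        · subst hij
          rw [ConnectedComponent.mem_supp_iff] at hx
          exact hne (by rw [Set.mem_singleton_iff, ← hx, hK₀]; congr 1; exact Subtype.ext hj)
        · exact hne' x hx (by rw [hj]; exact hij))
      refine ⟨x, hx, y, hxy, hy, fun hyC => hne' x hx ?_⟩
      rw [hxy]
      exact hyC
    choose x hx y hxy hy hyC using hrep
    have h1 : (D.coe.oddComponents \ {K₀} : Set _).ncard ≤ S.ncard := by
      rw [← Nat.card_coe_set_eq, ← Nat.card_coe_set_eq]
      refine Nat.card_le_card_of_injective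
        (fun K => ⟨Sum.inl ((y K).1, !(y K).2), (hy K).2.resolve_left (hyC K)⟩) ?_
      intro K K' h
      have h' : y K = y K' := by
        simpa [Prod.ext_iff] using h
      have h2 : x K = x K' := Subtype.ext (by rw [hxy, hxy, h'])
      have h3 := hx K
      rw [h2, ConnectedComponent.mem_supp_iff] at h3
      exact Subtype.ext (h3.symm.trans (hx K'))
    have h2 := Set.ncard_le_ncard_sdiff_add_ncard D.coe.oddComponents {K₀}
    rw [Set.ncard_singleton] at h2
    omega
  push Not at hW
  have hrep : ∀ K : D.coe.oddComponents, ∃ x ∈ K.1.supp, ∃ y : V × Bool,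
      x.1 = .inl y ∧ y ∈ lonely C (Sum.inl ⁻¹' S) := fun K =>
    exists_lonely_of_odd K.2 fun x _ i hxi => hmem x (hxi ▸ hW i)
  choose x hx y hxy hy using hrep
  have hyinj : Function.Injective y := by
    intro K K' h
    have h2 : x K = x K' := Subtype.ext (by rw [hxy, hxy, h])
    have h3 := hx K
    rw [h2, ConnectedComponent.mem_supp_iff] at h3
    exact Subtype.ext (h3.symm.trans (hx K'))
  set S₀ : Set (V × Bool) := Sum.inl ⁻¹' S with hS₀
  have hScard : S.ncard = S₀.ncard + d := by
    have : S = Sum.inl '' S₀ ∪ Set.range Sum.inr := by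
      ext (z | i)
      · simp [S₀]
      · simp [hW]
    rw [this, Set.ncard_union_eq (by simp [Set.disjoint_left]) (Set.toFinite _) (Set.toFinite _),
      Set.ncard_image_of_injective _ Sum.inl_injective, ← Set.image_univ,
      Set.ncard_image_of_injective _ Sum.inr_injective, Set.ncard_univ]
    simp
  -- There are at least `|S₀| + d + 2` odd components and at most `|S₀| + 2 * |C|` blocked vertices
  -- and lonely elements together. Sparing one lonely element per odd component leaves at most `2 *
  -- |C| - d - 2 = 2 * l - 2`.
  refine ⟨blocked C S₀ ∪ Prod.fst '' (lonely C S₀ \ Set.range y), ?_, fun u v p hp => ?_⟩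
  · have h1 := Set.ncard_union_le (blocked C S₀) (Prod.fst '' (lonely C S₀ \ Set.range y))
    have h2 := Set.ncard_image_le (f := Prod.fst) (Set.toFinite (lonely C S₀ \ Set.range y))
    have h3 := two_mul_ncard_blocked_add_ncard_lonely_le C S₀
    have h4 : (lonely C S₀ \ Set.range y).ncard + (Set.range y).ncard = (lonely C S₀).ncard :=
      Set.ncard_sdiff_add_ncard_of_subset (by rintro _ ⟨K, rfl⟩; exact hy K)
    have h5 : (Set.range y).ncard = D.coe.oddComponents.ncard := by
      rw [← Set.image_univ, Set.ncard_image_of_injective _ hyinj, Set.ncard_univ,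
        Nat.card_coe_set_eq]
    omega
  -- The class is the component; the value `none` on `S₀` is a dummy.
  · let κ : V × Bool → Option D.coe.ConnectedComponent := fun z =>
      if h : z ∈ S₀ then none
      else some (D.coe.connectedComponentMk ⟨.inl z, by simpa [D] using (show Sum.inl z ∉ S from h)⟩)
    refine not_breaksParity (X := blocked C S₀ ∪ Prod.fst '' (lonely C S₀ \ Set.range y))
      Set.subset_union_left κ ?_ ?_ hp
    · intro z z' hz hz' h
      simp only [κ, dif_neg hz, dif_neg hz']
      exact congrArg some (hadjD _ _ hz hz' h)
    · have hkey : ∀ z ∈ lonely C S₀,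
          z.1 ∉ blocked C S₀ ∪ Prod.fst '' (lonely C S₀ \ Set.range y) →
          ∃ K, y K = z ∧ κ z = some K.1 := by
        intro z hz hzX
        obtain ⟨K, rfl⟩ : z ∈ Set.range y := by
          by_contra h
          exact hzX (Or.inr ⟨z, ⟨hz, h⟩, rfl⟩)
        refine ⟨K, rfl, ?_⟩
        simp only [κ, dif_neg (hy K).1]
        have h3 := hx K
        rw [ConnectedComponent.mem_supp_iff] at h3
        rw [← h3]
        congr 2
        exact Subtype.ext (hxy K).symm
      intro z hz z' hz' h hzX hzX'
      obtain ⟨K, rfl, hK⟩ := hkey z hz hzX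
      obtain ⟨K', rfl, hK'⟩ := hkey z' hz' hzX'
      rw [hK, hK', Option.some_inj] at h
      rw [Subtype.ext h]

/-- **Packing and covering parity-breaking paths.** -/
theorem exists_disjoint_paths_or_hitting_set [Finite V] (G : SimpleGraph V) (C : Set V)
    (b : V → Bool) {l : ℕ} (hC : l ≤ C.ncard) :
    (∃ P : Fin l → Σ e : V × V, G.Walk e.1 e.2, (∀ i, BreaksParity C b (P i).2) ∧
      ∀ i j, i ≠ j → (P i).2.support.Disjoint (P j).2.support) ∨
    ∃ X : Set V, X.ncard ≤ 2 * l - 2 ∧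
      ∀ (u v : V) (p : G.Walk u v), BreaksParity C b p → ∃ a ∈ p.support, a ∈ X := by
  have hd : (2 * C.ncard - 2 * l) + 2 * l = 2 * C.ncard := by omega
  by_cases h : ∃ M : (augmentedPrism G C b (Fin (2 * C.ncard - 2 * l))).Subgraph,
      M.IsPerfectMatching
  · obtain ⟨M, hM⟩ := h
    exact Or.inl (exists_paths_of_isPerfectMatching hd hM)
  · rw [tutte] at h
    push Not at h
    obtain ⟨S, hS⟩ := h
    exact Or.inr (exists_hitting_set_of_isTutteViolator hd hS)

end Packing

/-! ### Parities of paths in nonbipartite blocks -/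

section Blocks

variable {V : Type*} {G : SimpleGraph V}

lemma toSubgraph_le_deleteVerts {B : G.Subgraph} {A : Set V} {u v : V} {p : G.Walk u v}
    (hB : p.toSubgraph ≤ B) (hA : ∀ a ∈ p.support, a ∉ A) : p.toSubgraph ≤ B.deleteVerts A := by
  have hmem : ∀ a ∈ p.toSubgraph.verts, a ∈ B.verts ∧ a ∉ A := fun a ha =>
    ⟨hB.1 ha, hA a (p.mem_verts_toSubgraph.mp ha)⟩
  refine ⟨fun a ha => hmem a ha, fun x y h => ?_⟩
  rw [Subgraph.deleteVerts_adj]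
  have hx := hmem x (p.toSubgraph.edge_vert h)
  have hy := hmem y (p.toSubgraph.edge_vert h.symm)
  exact ⟨hx.1, hx.2, hy.1, hy.2, hB.2 h⟩

lemma exists_walk_of_hom {V' : Type*} {K : SimpleGraph V'} (f : K →g G) {u v : V'} {x y : V}
    (hu : f u = x) (hv : f v = y) (p : K.Walk u v) : ∃ q : G.Walk x y, q.length = p.length ∧
      q.support = p.support.map f ∧ (Function.Injective f → p.IsPath → q.IsPath) := by
  subst hu hv
  exact ⟨p.map f, p.length_map f, p.support_map f, fun hf hp => hp.map hf⟩

/-- In a block that is not bipartite, any two vertices are joined by paths of both parities. -/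
lemma IsNonseparable.exists_isPath_of_parity [Finite V] {U : G.Subgraph} (hU : IsNonseparable U)
    (hodd : ¬ U.coe.IsBipartite) {x y : V} (hx : x ∈ U.verts) (hy : y ∈ U.verts) (hxy : x ≠ y)
    (k : ℕ) : ∃ p : G.Walk x y, p.IsPath ∧ (∀ a ∈ p.support, a ∈ U.verts) ∧
      Even (p.length + k) := by
  have hcut : ∀ v x y : U.verts, x ≠ v → y ≠ v → ∃ p : U.coe.Walk x y, v ∉ p.support := by
    rintro v x y hxv hyv
    have hmem : ∀ z : U.verts, z ≠ v → z.1 ∈ (U.deleteVerts {v.1}).verts := fun z hz =>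
      ⟨z.2, fun h => hz (Subtype.ext h)⟩
    obtain ⟨p⟩ := (hU.2 v v.2).coe ⟨x, hmem x hxv⟩ ⟨y, hmem y hyv⟩
    obtain ⟨q, -, hq, -⟩ := exists_walk_of_hom (Subgraph.inclusion Subgraph.deleteVerts_le)
      (x := x) (y := y) rfl rfl p
    refine ⟨q, ?_⟩
    rw [hq, List.mem_map]
    rintro ⟨z, -, hz⟩
    exact z.2.2 (congrArg Subtype.val hz)
  obtain ⟨p, hp, -, hk⟩ := joinedByBothParities_univ hU.1.preconnected.coe hcut hodd
    ⟨x, hx⟩ trivial ⟨y, hy⟩ trivial (by simpa using hxy) k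
  obtain ⟨q, hlen, hsupp, hpath⟩ := exists_walk_of_hom U.hom (x := x) (y := y) rfl rfl p
  refine ⟨q, hpath U.hom_injective hp, ?_, by rwa [hlen]⟩
  intro a ha
  rw [hsupp, List.mem_map] at ha
  obtain ⟨z, -, rfl⟩ := ha
  exact z.2

end Blocks

/-! ### Connectivity of what remains of a subdivision -/

namespace Subdivision

variable {W V : Type*} {F : SimpleGraph W} {G : SimpleGraph V}

/-- The union of the linking paths none of whose ends corresponds to an element of `D`. -/
def minus (H : Subdivision F G) (D : Set W) : G.Subgraph :=
  ⨆ (a : W) (b : W) (h : F.Adj a b) (_ : a ∉ D) (_ : b ∉ D), (H.link a b h).toSubgraph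

variable {H : Subdivision F G} {D : Set W}

lemma link_le_minus {a b : W} (h : F.Adj a b) (ha : a ∉ D) (hb : b ∉ D) :
    (H.link a b h).toSubgraph ≤ H.minus D :=
  le_iSup_of_le a <| le_iSup_of_le b <| le_iSup_of_le h <| le_iSup_of_le ha <|
    le_iSup_of_le hb le_rfl

lemma mem_verts_minus {v : V} : v ∈ (H.minus D).verts ↔
    ∃ (a b : W) (h : F.Adj a b), a ∉ D ∧ b ∉ D ∧ v ∈ (H.link a b h).support := by
  simp only [minus, Subgraph.verts_iSup, Set.mem_iUnion, Walk.mem_verts_toSubgraph, exists_prop]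

/-- If every vertex of `F` outside of `D` can be linked robustly to a dominating vertex, then what
remains of the subdivision stays connected after the deletion of at most one vertex. -/
lemma preconnected_minus_deleteVerts
    (hroot : ∀ e : W, ∃ a ∉ D, a ≠ e ∧ ∀ c ∉ D, c ≠ a → F.Adj c a)
    (hthird : ∀ a ∉ D, ∀ c ∉ D, F.Adj c a → ∃ e ∉ D, F.Adj c e ∧ F.Adj e a)
    {A : Set V} (hA : A.Subsingleton) : ((H.minus D).deleteVerts A).Preconnected := by
  set B := (H.minus D).deleteVerts A with hB
  let R : V → V → Prop := fun x y => ∃ p : G.Walk x y, p.toSubgraph ≤ B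
  have hsymm : ∀ {x y}, R x y → R y x := by
    rintro x y ⟨p, hp⟩
    exact ⟨p.reverse, by rwa [Walk.toSubgraph_reverse]⟩
  have htrans : ∀ {x y z}, R x y → R y z → R x z := by
    rintro x y z ⟨p, hp⟩ ⟨q, hq⟩
    exact ⟨p.append q, by rw [Walk.toSubgraph_append]; exact sup_le hp hq⟩
  have hlink : ∀ {c d} (h : F.Adj c d), c ∉ D → d ∉ D → (∀ v ∈ (H.link c d h).support, v ∉ A) →
      R (H.branch c) (H.branch d) := fun h hc hd hA' =>
    ⟨_, toSubgraph_le_deleteVerts (link_le_minus h hc hd) hA'⟩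
  rw [Subgraph.preconnected_iff_forall_exists_walk_subgraph]
  intro x y hx hy
  obtain ⟨w, -⟩ := mem_verts_minus.mp hx.1
  obtain ⟨a, haD, haA, hdom⟩ : ∃ a ∉ D, H.branch a ∉ A ∧ ∀ c ∉ D, c ≠ a → F.Adj c a := by
    by_cases h : ∃ e, H.branch e ∈ A
    · obtain ⟨e, he⟩ := h
      obtain ⟨a, haD, hae, hdom⟩ := hroot e
      exact ⟨a, haD, fun h => hae (H.branch.injective (hA h he)), hdom⟩
    · push Not at h
      obtain ⟨a, haD, -, hdom⟩ := hroot w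
      exact ⟨a, haD, h a, hdom⟩
  have hbranch : ∀ c ∉ D, H.branch c ∉ A → R (H.branch c) (H.branch a) := by
    intro c hc hcA
    by_cases hca : c = a
    · subst hca
      exact ⟨Walk.nil, toSubgraph_le_deleteVerts (by
        -- A second dominating vertex provides a linking path through the branch vertex of `c`.
        obtain ⟨a', ha', hne, hdom'⟩ := hroot c
        refine le_trans ?_ (link_le_minus (H := H) (hdom' c hc hne.symm) hc ha')
        simp) (by simpa using hcA)⟩
    have hadj := hdom c hc hca
    by_cases hgood : ∀ v ∈ (H.link c a hadj).support, v ∉ A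
    · exact hlink hadj hc haD hgood
    push Not at hgood
    obtain ⟨v, hv, hvA⟩ := hgood
    have hvb : v ∉ Set.range H.branch := by
      rintro ⟨e, rfl⟩
      rcases H.branch_mem_link _ _ hadj e hv with rfl | rfl
      exacts [hcA hvA, haA hvA]
    -- The deleted vertex is internal to the link from `c` to `a`, hence on no other link, and the
    -- detour via `e` avoids it.
    obtain ⟨e, he, hce, hea⟩ := hthird a haD c hc hadj
    refine htrans (hlink hce hc he ?_) (hlink hea he haD ?_) <;> intro z hz hzA <;>
      obtain rfl := hA hvA hzA
    · refine hvb (H.link_inter _ _ hadj _ _ hce ?_ _ hv hz)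
      have := hea.ne'
      grind
    · refine hvb (H.link_inter _ _ hadj _ _ hea ?_ _ hv hz)
      have := hce.ne
      grind
  have hany : ∀ x ∈ B.verts, R x (H.branch a) := by
    rintro x ⟨hx, hxA⟩
    obtain ⟨c, d, h, hc, hd, hxl⟩ := mem_verts_minus.mp hx
    obtain ⟨q, r, hqr⟩ := (H.link c d h).mem_support_iff_exists_append.mp hxl
    have hle : (q.append r).toSubgraph ≤ H.minus D := hqr ▸ link_le_minus h hc hd
    have hpath : (q.append r).IsPath := hqr ▸ H.link_isPath c d h
    rw [Walk.toSubgraph_append] at hle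
    -- The vertex `x` cuts its link into two pieces that share only `x`, so the deletion spares one
    -- of them.
    by_cases hq : ∀ v ∈ q.support, v ∉ A
    · exact htrans (hsymm ⟨q, toSubgraph_le_deleteVerts (le_sup_left.trans hle) hq⟩)
        (hbranch c hc (hq _ (Walk.start_mem_support _)))
    · push Not at hq
      obtain ⟨v, hv, hvA⟩ := hq
      have hr : ∀ z ∈ r.support, z ∉ A := by
        intro z hz hzA
        obtain rfl := hA hvA hzA
        obtain rfl := eq_of_mem_of_isPath_append hpath hv hz
        exact hxA hvA
      exact htrans ⟨r, toSubgraph_le_deleteVerts (le_sup_right.trans hle) hr⟩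
        (hbranch d hd (hr _ (Walk.end_mem_support _)))
  exact htrans (hany x hx) (hsymm (hany y hy))

lemma isNonseparable_minus [Nonempty W]
    (hroot : ∀ e : W, ∃ a ∉ D, a ≠ e ∧ ∀ c ∉ D, c ≠ a → F.Adj c a)
    (hthird : ∀ a ∉ D, ∀ c ∉ D, F.Adj c a → ∃ e ∉ D, F.Adj c e ∧ F.Adj e a) :
    IsNonseparable (H.minus D) := by
  refine ⟨?_, fun v _ => preconnected_minus_deleteVerts hroot hthird Set.subsingleton_singleton⟩
  rw [Subgraph.connected_iff]
  constructor
  · simpa using preconnected_minus_deleteVerts (H := H) hroot hthird (A := ∅) Set.subsingleton_empty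
  · obtain ⟨a, ha, -, -⟩ := hroot (Classical.arbitrary W)
    obtain ⟨c, hc, hca, hdom⟩ := hroot a
    exact ⟨H.branch a, mem_verts_minus.mpr ⟨a, c, hdom a ha hca.symm, ha, hc,
      Walk.start_mem_support _⟩⟩

/-- Every vertex of `G` can be charged to one vertex of `F` such that it lies only on linking paths
that end there. -/
lemma exists_charge [Nonempty W] (H : Subdivision F G) (x : V) : ∃ e : W,
    (∀ a, H.branch a = x → a = e) ∧
      ∀ (a b : W) (h : F.Adj a b), x ∈ (H.link a b h).support → e = a ∨ e = b := by
  by_cases h : ∃ e, H.branch e = x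
  · obtain ⟨e, rfl⟩ := h
    exact ⟨e, fun a ha => H.branch.injective ha, fun a b h hx => H.branch_mem_link a b h e hx⟩
  by_cases h' : ∃ (a b : W) (h : F.Adj a b), x ∈ (H.link a b h).support
  · obtain ⟨a, b, hab, hx⟩ := h'
    refine ⟨a, fun c hc => absurd ⟨c, hc⟩ h, fun c d hcd hx' => ?_⟩
    by_contra hne
    refine h (H.link_inter a b hab c d hcd (fun heq => hne ?_) x hx hx')
    rw [Sym2.eq_iff] at heq
    exact heq.imp And.left And.left
  · exact ⟨Classical.arbitrary W, fun a ha => absurd ⟨a, ha⟩ h,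
      fun a b hab hx => absurd ⟨a, b, hab, hx⟩ h'⟩

end Subdivision

/-! ### The graph `K_s + I_t` after the loss of at most `s - 2` vertices -/

section CompleteJoin

variable {s t : ℕ}

lemma completeJoinIndep_adj_inl (i : Fin s) (c : Fin s ⊕ Fin t) :
    (completeJoinIndep s t).Adj c (.inl i) ↔ c ≠ .inl i := by
  rcases c with c | c <;> simp [completeJoinIndep, join]

lemma exists_inl_notMem {D : Finset (Fin s ⊕ Fin t)} (h : D.card < s) :
    ∃ i : Fin s, Sum.inl i ∉ D := by
  classical
  obtain ⟨x, hx, hxD⟩ := Finset.exists_mem_notMem_of_card_lt_card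
    (s := D) (t := Finset.univ.map (Function.Embedding.inl : Fin s ↪ Fin s ⊕ Fin t)) (by simpa)
  rw [Finset.mem_map] at hx
  obtain ⟨i, -, rfl⟩ := hx
  exact ⟨i, hxD⟩

lemma isNonseparable_minus_completeJoinIndep {V : Type*} {G : SimpleGraph V}
    (H : Subdivision (completeJoinIndep s t) G) (ht : 1 ≤ t) {D : Finset (Fin s ⊕ Fin t)}
    (hD : D.card + 2 ≤ s) : IsNonseparable (H.minus (D : Set (Fin s ⊕ Fin t))) := by
  classical
  have : Nonempty (Fin s ⊕ Fin t) := ⟨.inr ⟨0, ht⟩⟩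
  have hins : ∀ e, (insert e D).card < s := fun e => (Finset.card_insert_le e D).trans_lt (by omega)
  refine Subdivision.isNonseparable_minus ?_ ?_
  · intro e
    obtain ⟨i, hi⟩ := exists_inl_notMem (hins e)
    rw [Finset.mem_insert, not_or] at hi
    exact ⟨.inl i, by simpa using hi.2, hi.1, fun c _ hc => (completeJoinIndep_adj_inl i c).2 hc⟩
  · have key : ∀ (j : Fin s) (c : Fin s ⊕ Fin t), c ≠ .inl j → ∃ e ∉ (D : Set (Fin s ⊕ Fin t)),
        (completeJoinIndep s t).Adj c e ∧ (completeJoinIndep s t).Adj e (.inl j) := by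
      rintro j (i | i) hne
      -- Any third vertex is adjacent to both ends. One exists outside `D` because `|D| + 2 ≤ s < s
      -- + t`.
      · obtain ⟨e, -, he⟩ := Finset.exists_mem_notMem_of_card_lt_card
          (s := insert (.inl i) (insert (.inl j) D)) (t := (Finset.univ : Finset (Fin s ⊕ Fin t))) (by
            have := Finset.card_insert_le (.inl i) (insert (.inl j) D)
            have := Finset.card_insert_le (.inl j) D
            simp only [Finset.card_univ, Fintype.card_sum, Fintype.card_fin]
            omega)
        simp only [Finset.mem_insert, not_or] at he
        exact ⟨e, by simpa using he.2.2, ((completeJoinIndep_adj_inl i e).2 he.1).symm,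
          (completeJoinIndep_adj_inl j e).2 he.2.1⟩
      · obtain ⟨i', hi'⟩ := exists_inl_notMem (hins (.inl j))
        rw [Finset.mem_insert, not_or] at hi'
        exact ⟨.inl i', by simpa using hi'.2, (completeJoinIndep_adj_inl i' _).2 (by simp),
          (completeJoinIndep_adj_inl j _).2 hi'.1⟩
    rintro (j | j) _ c _ hadj
    · exact key j c hadj.ne
    · rcases c with c | c
      · obtain ⟨e, he, h1, h2⟩ := key c (.inr j) (by simp)
        exact ⟨e, he, h2.symm, h1.symm⟩
      · simp [completeJoinIndep, join] at hadj

end CompleteJoin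

/-! ### The bipartite block and the conclusion -/

section Main

variable {V : Type*} {G : SimpleGraph V}

/-- Translates the congruence in the definition of parity-breaking into the Boolean form used by
`BreaksParity`. -/
lemma fin_two_parity (i j : Fin 2) (n : ℕ) :
    ¬ ((n : ℤ) ≡ ((i : ℕ) : ℤ) - ((j : ℕ) : ℤ) [ZMOD 2]) ↔ (i = j ↔ Odd n) := by
  rw [Int.modEq_iff_dvd, Nat.odd_iff]
  fin_cases i <;> fin_cases j <;> simp <;> omega

lemma Subdivision.branch_mem_verts {W : Type*} {F : SimpleGraph W} (H : Subdivision F G) (a : W) :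
    H.branch a ∈ H.toSubgraph.verts := by
  simp only [Subdivision.toSubgraph, Subgraph.verts_sup, Subgraph.verts_iSup, Set.mem_union,
    Set.mem_iUnion]
  exact Or.inl ⟨a, by simp⟩

lemma hasDisjointParityBreakingPaths {W : Type*} {F : SimpleGraph W} (H : Subdivision F G)
    (β : H.toSubgraph.coe.Coloring (Fin 2)) {b : V → Bool}
    (hb : ∀ v (hv : v ∈ H.toSubgraph.verts), b v = decide (β ⟨v, hv⟩ = 1)) {l : ℕ}
    (P : Fin l → Σ e : V × V, G.Walk e.1 e.2) (hP : ∀ i, BreaksParity H.branchSet b (P i).2)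
    (hd : ∀ i j, i ≠ j → (P i).2.support.Disjoint (P j).2.support) :
    HasDisjointParityBreakingPaths G H.toSubgraph H.branchSet l := by
  refine ⟨fun i => (P i).1.1, fun i => (P i).1.2, fun i => (P i).2, fun i => ?_, hd⟩
  obtain ⟨hpath, hu, hv, huv, hpar⟩ := hP i
  have hmem : ∀ v ∈ H.branchSet, v ∈ H.toSubgraph.verts := by
    rintro _ ⟨a, rfl⟩
    exact H.branch_mem_verts a
  refine ⟨⟨hpath, hu, hv, huv⟩, β, ⟨hpath, hmem _ hu, hmem _ hv, huv⟩, hmem _ hu, hmem _ hv, ?_⟩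
  rw [fin_two_parity, ← hpar, hb _ (hmem _ hu), hb _ (hmem _ hv)]
  generalize β ⟨_, hmem _ hu⟩ = x
  generalize β ⟨_, hmem _ hv⟩ = y
  revert x y
  decide

/-- If a set `X` meets all paths between branch vertices that break parity, then the part of the
subdivision that avoids `X` lies in a bipartite block of `G - X`. -/
lemma exists_bipartite_block [Finite V] {s t : ℕ} (ht : 1 ≤ t)
    (H : Subdivision (completeJoinIndep s t) G) (b : V → Bool) (X : Finset V)
    (hXs : X.card + 2 ≤ s)
    (hX : ∀ (u v : V) (p : G.Walk u v), BreaksParity H.branchSet b p → ∃ a ∈ p.support, a ∈ X) :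
    ∃ U : G.Subgraph, IsBlockOf ((⊤ : G.Subgraph).deleteVerts (X : Set V)) U ∧
      U.coe.IsBipartite ∧
      ∃ C' : Finset V, (C' : Set V) ⊆ H.branchSet \ (X : Set V) ∧ s + t - X.card ≤ C'.card ∧
        (C' : Set V) ⊆ U.verts ∧
        ∀ (a b : Fin s ⊕ Fin t) (h : (completeJoinIndep s t).Adj a b),
          H.branch a ∈ C' → H.branch b ∈ C' → (H.link a b h).toSubgraph ≤ U := by
  classical
  have : Nonempty (Fin s ⊕ Fin t) := ⟨.inr ⟨0, ht⟩⟩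
  choose f hfb hfl using H.exists_charge
  -- A link whose ends are not charged avoids `X`. Hence `C'` consists of the uncharged branch
  -- vertices, at least `s + t - |X|` in number.
  set D : Finset (Fin s ⊕ Fin t) := X.image f with hD
  have hDcard : D.card ≤ X.card := Finset.card_image_le
  have hsep := isNonseparable_minus_completeJoinIndep H ht (D := D) (by omega)
  have hle : H.minus (D : Set (Fin s ⊕ Fin t)) ≤ (⊤ : G.Subgraph).deleteVerts (X : Set V) := by
    refine iSup_le fun a => iSup_le fun c => iSup_le fun h => iSup_le fun ha => iSup_le fun hc => ?_
    refine toSubgraph_le_deleteVerts le_top fun x hx hxX => ?_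
    have hfx : f x ∈ D := Finset.mem_image_of_mem f hxX
    rcases hfl x a c h hx with h | h
    exacts [ha (h ▸ hfx), hc (h ▸ hfx)]
  obtain ⟨U, hHU, hU⟩ := Set.Finite.exists_le_maximal
    (s := {B : G.Subgraph | B ≤ (⊤ : G.Subgraph).deleteVerts (X : Set V) ∧ IsNonseparable B})
    (Set.toFinite _) ⟨hle, hsep⟩
  have hbranchU : ∀ a ∉ D, H.branch a ∈ U.verts := by
    intro a ha
    obtain ⟨i, hi⟩ := exists_inl_notMem (D := insert a D)
      ((Finset.card_insert_le a D).trans_lt (by omega))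
    rw [Finset.mem_insert, not_or] at hi
    exact hHU.1 (Subdivision.mem_verts_minus.mpr ⟨a, .inl i,
      (completeJoinIndep_adj_inl i a).2 (Ne.symm hi.1), ha, hi.2, Walk.start_mem_support _⟩)
  have hUX : ∀ v ∈ U.verts, v ∉ X := fun v hv => by
    simpa using (hU.prop.1.1 hv).2
  have hCD : ∀ a, H.branch a ∈ (Finset.univ \ D).map H.branch → a ∉ D := by
    intro a ha
    simpa using ha
  refine ⟨U, hU, ?_, (Finset.univ \ D).map H.branch, ?_, ?_, ?_, ?_⟩
  · by_contra hodd
    obtain ⟨i, hi⟩ := exists_inl_notMem (D := D) (by omega)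
    obtain ⟨j, hj⟩ := exists_inl_notMem (D := insert (.inl i) D)
      ((Finset.card_insert_le _ D).trans_lt (by omega))
    rw [Finset.mem_insert, not_or] at hj
    have hne : H.branch (.inl i) ≠ H.branch (.inl j) := fun h => hj.1 (H.branch.injective h).symm
    -- The parity is chosen to break the colouring: odd length for equal colours, even length for
    -- different ones.
    obtain ⟨p, hp, hpU, hk⟩ := hU.prop.2.exists_isPath_of_parity hodd (hbranchU _ hi)
      (hbranchU _ hj.2) hne (if b (H.branch (.inl i)) = b (H.branch (.inl j)) then 1 else 0)
    obtain ⟨a, hap, haX⟩ := hX _ _ p ⟨hp, ⟨_, rfl⟩, ⟨_, rfl⟩, hne, by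
      split_ifs at hk with h
      · simp only [h, true_iff]
        grind
      · simp only [h, false_iff]
        grind⟩
    exact hUX a (hpU a hap) haX
  · intro v hv
    rw [Finset.mem_coe, Finset.mem_map] at hv
    obtain ⟨a, ha, rfl⟩ := hv
    exact ⟨⟨a, rfl⟩, hUX _ (hbranchU a (by simpa using ha))⟩
  · rw [Finset.card_map, Finset.card_sdiff_of_subset (Finset.subset_univ _), Finset.card_univ,
      Fintype.card_sum, Fintype.card_fin, Fintype.card_fin]
    omega
  · intro v hv
    rw [Finset.mem_coe, Finset.mem_map] at hv
    obtain ⟨a, ha, rfl⟩ := hv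
    exact hbranchU a (by simpa using ha)
  · intro a c h ha hc
    exact (Subdivision.link_le_minus h (hCD a ha) (hCD c hc)).trans hHU

end Main

end ParityBreak

theorem mainTheorem6 {V : Type*} [Finite V] (G : SimpleGraph V) (l s t : ℕ)
    (hl : 1 ≤ l) (hs : 2 * l ≤ s) (ht : 1 ≤ t)
    (H : ParityBreak.Subdivision (ParityBreak.completeJoinIndep s t) G)
    (hH : H.toSubgraph.coe.IsBipartite) :
    (∃ X : Finset V, X.card ≤ 2 * l - 2 ∧
      ∃ U : G.Subgraph,
        ParityBreak.IsBlockOf ((⊤ : G.Subgraph).deleteVerts (X : Set V)) U ∧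
        U.coe.IsBipartite ∧
        ∃ C' : Finset V, (C' : Set V) ⊆ H.branchSet \ (X : Set V) ∧
          s + t - X.card ≤ C'.card ∧
          (C' : Set V) ⊆ U.verts ∧
          ∀ (a b : Fin s ⊕ Fin t) (h : (ParityBreak.completeJoinIndep s t).Adj a b),
            H.branch a ∈ C' → H.branch b ∈ C' → (H.link a b h).toSubgraph ≤ U) ∨
    ParityBreak.HasDisjointParityBreakingPaths G H.toSubgraph H.branchSet l := by
  classical
  obtain ⟨β⟩ := hH
  let b : V → Bool := fun v =>
    if hv : v ∈ H.toSubgraph.verts then decide (β ⟨v, hv⟩ = 1) else false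
  have hcard : H.branchSet.ncard = s + t := by
    rw [ParityBreak.Subdivision.branchSet, ← Set.image_univ,
      Set.ncard_image_of_injective _ H.branch.injective, Set.ncard_univ]
    simp
  rcases ParityBreak.exists_disjoint_paths_or_hitting_set G H.branchSet b (l := l) (by omega) with
    ⟨P, hP, hd⟩ | ⟨X, hXcard, hX⟩
  · exact Or.inr (ParityBreak.hasDisjointParityBreakingPaths H β
      (fun v hv => by simp only [b, dif_pos hv]) P hP hd)
  · have hXcard' : X.toFinite.toFinset.card ≤ 2 * l - 2 := by
      rwa [← Set.ncard_eq_toFinset_card]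
    exact Or.inl ⟨X.toFinite.toFinset, hXcard',
      ParityBreak.exists_bipartite_block ht H b _ (by omega) (by simpa using hX)⟩
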